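/- Let $E$ be a reflexive real Banach space whose dual is separable, let $[t_0,T]\subset\mathbb R$, and let $(\Omega,\mathcal F,(\mathcal F_t)_{t\in[t_0,T]},\mathbb P)$ be a complete filtered probability space satisfying the usual conditions (the filtration is right-continuous and every $\mathcal F_t$ contains all $\mathbb P$-null sets). A set-valued map $X$ on a measurable space $(M,\mathcal M)$ with values in the subsets of $E$ is called $\mathcal M$-measurable if $\{m: X(m)\cap O\neq\emptyset\}\in\mathcal M$ for every open $O\subseteq E$. A random closed set is an $\mathcal F$-measurable map on $\Omega$ whose values are non-empty closed subsets of $E$. Let $B=(B_t)_{t\in[t_0,T]}$ and $G=(G_t)_{t\in[t_0,T]}$ be families of maps from $\Omega$ to the non-empty closed subsets of $E$ such that: - $B_t$ is $\mathcal F_t$-measurable for every $t\in[t_0,T]$, and $B_s(\omega)\subseteq B_t(\omega)$ for all $\omega$ and all $s<t$ in $[t_0,T]$; - $0\in G(\omega,t)$ and $G(\omega,t)$ is convex for all $(\omega,t)$, and there is a closed bounded $K\subseteq E$ with $G(\omega,t)\subseteq K$ for all $(\omega,t)$; - $G$ is measurable with respect to the previsible $\sigma$-algebra on $\Omega\times[t_0,T]$,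 that is, the smallest $\sigma$-algebra for which every process $X$ that has non-empty closed values in $E$, is adapted, and almost surely has trajectories left-continuous in the Hausdorff distance at every point of $[t_0,T]$, is a measurable set-valued map. For $A,C\subseteq E$ put $A\oplus C=\overline{\{a+c: a\in A,\ c\in C\}}$ (so $\emptyset\oplus C=\emptyset$). For $a\le b$ in $[t_0,T]$ let $\int_a^b G(\tau)\,d\tau$ be the Aumann integral with respect to Lebesgue measure: its value at $\omega$ is the set of all Bochner integrals $\int_a^b x(\tau)\,d\tau$ with $x\in L^1([t_0,T];E)$ and $x(\tau)\in G(\omega,\tau)$ for almost every $\tau$. Let $t\in[t_0,T]$, $n\in\mathbb N=\{0,1,2,\dots\}$, and let $\Pi=(t_i)_{i=0}^n$, $t_0<t_1<\dots<t_n=t$, be a partition of $[t_0,t]$. Put $\Delta B_{t_i}=B_{t_i}\setminus \operatorname{int} B_{t_{i-1}}$ for $1\le i\le n$, and $$s_\Pi=\Bigl(B_{t_0}\oplus\int_{t_0}^tG(\tau)\,d\tau\Bigr)\cup\bigcup_{i=1}^n\Bigl(\Delta B_{t_i}\oplus\int_{t_i}^tG(\tau)\,d\tau\Bigr),$$ $$S_\Pi=\Bigl(B_{t_0}\oplus\int_{t_0}^tG(\tau)\,d\tau\Bigr)\cup\bigcup_{i=1}^n\Bigl(\Delta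 B_{t_i}\oplus\int_{t_{i-1}}^tG(\tau)\,d\tau\Bigr).$$ Then both $s_\Pi$ and $S_\Pi$ are random closed sets. -/

import Mathlib

open MeasureTheory Filter Topology Set

open scoped Pointwise

namespace BirthGrowth

/-- Measurability of a set-valued map `X` with respect to a σ-algebra `m`: the inverse image
`X⁻¹(O) = {a | X a ∩ O ≠ ∅}` of every open set `O` belongs to `m`. -/
def IsMeasurableSetValued {α E : Type*} [TopologicalSpace E] (m : MeasurableSpace α)
    (X : α → Set E) : Prop :=
  ∀ O : Set E, IsOpen O → MeasurableSet[m] {a | (X a ∩ O).Nonempty}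

/-- `X` is a measurable set-valued map (with respect to `m`) with non-empty closed values.
When `m` is the σ-algebra of a complete probability space, this says that `X` is a random
closed set. -/
structure IsRandomClosedSet {α E : Type*} [TopologicalSpace E] (m : MeasurableSpace α)
    (X : α → Set E) : Prop where
  nonempty : ∀ a, (X a).Nonempty
  isClosed : ∀ a, IsClosed (X a)
  measurable : IsMeasurableSetValued m X

/-- The closed Minkowski sum `A ⊕ B`, the closure of `A + B = {a + b | a ∈ A, b ∈ B}`. -/
def closedMinkowskiSum {E : Type*} [TopologicalSpace E] [Add E] (A B : Set E) : Set E :=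
  closure (A + B)

/-- The Aumann integral `∫_A X dμ`: the set of all Bochner integrals `∫_A x dμ`, where `x` runs
through the `μ`-integrable functions with `x ∈ X` almost everywhere. -/
def aumannIntegral {α E : Type*} [MeasurableSpace α] [NormedAddCommGroup E] [NormedSpace ℝ E]
    (μ : Measure α) (A : Set α) (X : α → Set E) : Set E :=
  {y | ∃ x : α → E, Integrable x μ ∧ (∀ᵐ a ∂μ, x a ∈ X a) ∧ y = ∫ a in A, x a ∂μ}

/-- A Banach space is reflexive if the canonical map into its bidual is onto. -/
def IsReflexiveSpace (E : Type*) [NormedAddCommGroup E] [NormedSpace ℝ E] : Prop :=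
  Function.Surjective (NormedSpace.inclusionInDoubleDual ℝ E)

/-- Lebesgue measure on the compact interval `[t₀, T]`. -/
noncomputable def lebesgueIcc (t₀ T : ℝ) : Measure (Icc t₀ T) :=
  (volume : Measure ℝ).comap Subtype.val

section SetProcesses

variable {Ω E : Type*} {mΩ : MeasurableSpace Ω} {t₀ T : ℝ}

/-- The usual conditions: the filtration is right-continuous and each of its members contains
all `ℙ`-null sets. -/
structure UsualConditions (ℙ : Measure Ω) (ℱ : Filtration (Icc t₀ T) mΩ) : Prop where
  rightContinuous : ℱ.IsRightContinuous
  null : ∀ (t : Icc t₀ T) (N : Set Ω), ℙ N = 0 → MeasurableSet[ℱ t] N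

/-- `X` is an adapted process with non-empty closed values. -/
def IsAdaptedClosed [TopologicalSpace E] (ℱ : Filtration (Icc t₀ T) mΩ)
    (X : Ω → Icc t₀ T → Set E) : Prop :=
  ∀ t, IsRandomClosedSet (ℱ t) (fun ω => X ω t)

/-- Almost surely, the trajectory of `X` is left-continuous in the Hausdorff distance at every
point of `[t₀, T]`. -/
def HasLeftContinuousTrajectories [PseudoEMetricSpace E] (ℙ : Measure Ω)
    (X : Ω → Icc t₀ T → Set E) : Prop :=
  ∀ᵐ ω ∂ℙ, ∀ u : Icc t₀ T,
    Tendsto (fun s => Metric.hausdorffEDist (X ω s) (X ω u)) (𝓝[<] u) (𝓝 0)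

/-- The previsible σ-algebra on `Ω × [t₀, T]`: the one generated by the adapted processes with
non-empty closed values in `E` and left-continuous trajectories, i.e. the smallest σ-algebra for
which all these processes are measurable set-valued maps. -/
@[reducible]
def previsible (E : Type*) [PseudoEMetricSpace E] (ℙ : Measure Ω)
    (ℱ : Filtration (Icc t₀ T) mΩ) : MeasurableSpace (Ω × Icc t₀ T) :=
  MeasurableSpace.generateFrom
    {S | ∃ (X : Ω → Icc t₀ T → Set E) (O : Set E),
      IsAdaptedClosed ℱ X ∧ HasLeftContinuousTrajectories ℙ X ∧ IsOpen O ∧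
        S = {p : Ω × Icc t₀ T | (X p.1 p.2 ∩ O).Nonempty}}

/-- `t₀ = p 0 < p 1 < ⋯ < p n = t` is a partition of `[t₀, t]`. -/
structure IsPartition (t : Icc t₀ T) {n : ℕ} (p : Fin (n + 1) → Icc t₀ T) : Prop where
  strictMono : StrictMono p
  first : (p 0 : ℝ) = t₀
  last : p (Fin.last n) = t

variable [NormedAddCommGroup E] [NormedSpace ℝ E]

/-- The increment `ΔB_{t_i} = B_{t_i} \ int B_{t_{i-1}}` for `i = 1, …, n` (indexed here by
`i - 1 : Fin n`). -/
def increment (B : Ω → Icc t₀ T → Set E) {n : ℕ} (p : Fin (n + 1) → Icc t₀ T) (i : Fin n)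
    (ω : Ω) : Set E :=
  B ω (p i.succ) \ interior (B ω (p i.castSucc))

/-- The Aumann integral `∫_a^b G(ω, τ) dτ`. -/
noncomputable def growth (G : Ω → Icc t₀ T → Set E) (a b : Icc t₀ T) (ω : Ω) : Set E :=
  aumannIntegral (lebesgueIcc t₀ T) (Icc a b) (G ω)

/-- The lower sum
`s_Π(t) = (B_{t_0} ⊕ ∫_{t_0}^t G) ∪ ⋃_{i=1}^n (ΔB_{t_i} ⊕ ∫_{t_i}^t G)`. -/
noncomputable def lowerSum (B G : Ω → Icc t₀ T → Set E) (t : Icc t₀ T) {n : ℕ}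
    (p : Fin (n + 1) → Icc t₀ T) (ω : Ω) : Set E :=
  closedMinkowskiSum (B ω (p 0)) (growth G (p 0) t ω) ∪
    ⋃ i : Fin n, closedMinkowskiSum (increment B p i ω) (growth G (p i.succ) t ω)

/-- The upper sum
`S_Π(t) = (B_{t_0} ⊕ ∫_{t_0}^t G) ∪ ⋃_{i=1}^n (ΔB_{t_i} ⊕ ∫_{t_{i-1}}^t G)`. -/
noncomputable def upperSum (B G : Ω → Icc t₀ T → Set E) (t : Icc t₀ T) {n : ℕ}
    (p : Fin (n + 1) → Icc t₀ T) (ω : Ω) : Set E :=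
  closedMinkowskiSum (B ω (p 0)) (growth G (p 0) t ω) ∪
    ⋃ i : Fin n, closedMinkowskiSum (increment B p i ω) (growth G (p i.castSucc) t ω)

end SetProcesses

end BirthGrowth

/-!
The increment decomposes as `Y \ int X = (Y \ X) ∪ ∂X` when `X ⊆ Y` is closed. For `y ∈ Y \ X`, a
small basic open set `V ∋ y` misses `X` and meets `Y`; an open connected set meets `∂X` exactly when
it meets both `X` and its complement. So both pieces are measurable, and unions, Minkowski sums and
closures preserve measurability.

For the integral, an adapted left-continuous process is the pointwise limit of its values on grid
points strictly to the left, hence jointly measurable off an evanescent set; `G` therefore agrees,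
for almost every `ω`, with a map measurable for the product σ-algebra. By Hiai and Umegaki, the
distance in `L¹` from `h` to the set of integrable selections of `G ω` is
`∫ d(h(τ), G(ω, τ)) dτ`, which is measurable in `ω` by Tonelli's theorem. Since `L¹` is separable,
this makes the set of integrable selections measurable in `ω`, and the Aumann integral is its image
under a continuous map. Completeness of `ℙ` absorbs the exceptional null set.
-/

open scoped ENNReal NNReal

open TopologicalSpace (IsTopologicalBasis SeparableSpace countableBasis countable_countableBasis
  denseRange_denseSeq denseSeq isBasis_countableBasis isOpen_of_mem_countableBasis)

namespace BirthGrowth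

section Dual

variable {𝕜 E : Type*} [RCLike 𝕜] [NormedAddCommGroup E] [NormedSpace 𝕜 E]

theorem dense_of_forall_dual_eq_zero {S : Submodule 𝕜 E}
    (hS : ∀ f : StrongDual 𝕜 E, (∀ x ∈ S, f x = 0) → f = 0) : Dense (S : Set E) := by
  rw [Submodule.dense_iff_topologicalClosure_eq_top, Submodule.eq_top_iff']
  intro v
  have : IsClosed (S.topologicalClosure : Set E) := S.isClosed_topologicalClosure
  rw [← Submodule.Quotient.mk_eq_zero]
  by_contra hv
  obtain ⟨g, hg⟩ := SeparatingDual.exists_ne_zero (R := 𝕜) hv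
  refine hg (DFunLike.congr_fun (hS (g.comp S.topologicalClosure.mkQL) fun x hx => ?_) v)
  have hx' := (Submodule.Quotient.mk_eq_zero _).2 (S.le_topologicalClosure hx)
  exact (congrArg g hx').trans (map_zero g)

variable (𝕜 E) in
theorem separableSpace_of_separableSpace_dual [SeparableSpace (StrongDual 𝕜 E)] :
    SeparableSpace E := by
  have exists_norming (f : StrongDual 𝕜 E) : ∃ x : E, ‖x‖ ≤ 1 ∧ ‖f‖ ≤ 2 * ‖f x‖ := by
    rcases eq_or_ne f 0 with rfl | hf
    · exact ⟨0, by simp⟩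
    · obtain ⟨x, hx, hfx⟩ := f.exists_lt_apply_of_lt_opNorm (half_lt_self (norm_pos_iff.2 hf))
      exact ⟨x, hx.le, by linarith⟩
  choose x hx hfx using exists_norming
  let S := Submodule.span 𝕜 (range fun n => x (denseSeq (StrongDual 𝕜 E) n))
  suffices hS : Dense (S : Set E) by
    rw [← TopologicalSpace.isSeparable_univ_iff, ← hS.closure_eq]
    exact (countable_range _).isSeparable.span.closure
  refine dense_of_forall_dual_eq_zero fun f hf => ?_
  have norm_le (n : ℕ) : ‖f‖ ≤ 3 * ‖denseSeq (StrongDual 𝕜 E) n - f‖ := by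
    set g := denseSeq (StrongDual 𝕜 E) n
    have hfg : f (x g) = 0 := hf _ (Submodule.subset_span ⟨n, rfl⟩)
    have hgx : ‖g (x g)‖ ≤ ‖g - f‖ := by
      simpa [hfg] using (g - f).le_of_opNorm_le_of_le le_rfl (hx g)
    linarith [hfx g, norm_le_norm_add_norm_sub g f]
  refine norm_le_zero_iff.1 (le_of_forall_pos_le_add fun ε hε => ?_)
  obtain ⟨n, hn⟩ := (denseRange_denseSeq (StrongDual 𝕜 E)).exists_dist_lt f
    (show 0 < ε / 3 by positivity)
  rw [dist_comm, dist_eq_norm] at hn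
  linarith [norm_le n]

end Dual

section SetValued

variable {α E F : Type*} {m : MeasurableSpace α}

theorem frontier_inter_nonempty_iff [TopologicalSpace E] {S U : Set E}
    (hU' : IsPreconnected U) (hU : IsOpen U) :
    (frontier S ∩ U).Nonempty ↔ (S ∩ U).Nonempty ∧ (Sᶜ ∩ U).Nonempty := by
  rw [frontier_eq_closure_inter_closure]
  refine ⟨fun ⟨x, ⟨hxS, hxS'⟩, hxU⟩ => ?_, fun ⟨hS, hS'⟩ => ?_⟩
  · exact ⟨(closure_inter_open_nonempty_iff hU).1 ⟨x, hxS, hxU⟩,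
      (closure_inter_open_nonempty_iff hU).1 ⟨x, hxS', hxU⟩⟩
  · rw [inter_comm] at hS hS' ⊢
    refine isPreconnected_closed_iff.1 hU' _ _ isClosed_closure isClosed_closure ?_
      (hS.mono (inter_subset_inter_right U subset_closure))
      (hS'.mono (inter_subset_inter_right U subset_closure))
    rw [← closure_union, union_compl_self, closure_univ]
    exact subset_univ U

theorem nonempty_inter_iff_exists_infEDist_lt [PseudoEMetricSpace E] {D : Set E} (hD : Dense D)
    {S O : Set E} (hO : IsOpen O) :
    (S ∩ O).Nonempty ↔ ∃ u ∈ D, ∃ k : ℕ, Metric.eball u (k : ℝ≥0∞)⁻¹ ⊆ O ∧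
      Metric.infEDist u S < (k : ℝ≥0∞)⁻¹ := by
  constructor
  · rintro ⟨x, hxS, hxO⟩
    obtain ⟨ε, hε, hεO⟩ := EMetric.isOpen_iff.1 hO x hxO
    obtain ⟨k, hk⟩ := ENNReal.exists_inv_nat_lt (ENNReal.half_pos hε.ne').ne'
    obtain ⟨u, huD, hu⟩ := EMetric.mem_closure_iff.1 (hD x) (k : ℝ≥0∞)⁻¹ (by simp)
    have hku : Metric.eball u (k : ℝ≥0∞)⁻¹ ⊆ Metric.eball x ε := by
      rw [edist_comm] at hu
      refine Metric.eball_subset ?_ hu.ne_top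
      calc edist u x + (k : ℝ≥0∞)⁻¹ ≤ ε / 2 + ε / 2 := add_le_add (hu.trans hk).le hk.le
        _ = ε := ENNReal.add_halves ε
    exact ⟨u, huD, k, hku.trans hεO, Metric.infEDist_lt_iff.2 ⟨x, hxS, by rwa [edist_comm]⟩⟩
  · rintro ⟨u, -, k, hk, h⟩
    obtain ⟨y, hy, hyu⟩ := Metric.infEDist_lt_iff.1 h
    exact ⟨y, hy, hk (by rwa [Metric.mem_eball'])⟩

namespace IsMeasurableSetValued

section TopologicalSpace

variable [TopologicalSpace E] [TopologicalSpace F] {X Y : α → Set E}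

theorem mono {m' : MeasurableSpace α} (hX : IsMeasurableSetValued m' X) (h : m' ≤ m) :
    IsMeasurableSetValued m X :=
  fun O hO => h _ (hX O hO)

theorem const (S : Set E) : IsMeasurableSetValued m fun _ : α => S :=
  fun _ _ => MeasurableSet.const _

theorem of_isTopologicalBasis [SecondCountableTopology E] {b : Set (Set E)}
    (hb : IsTopologicalBasis b) (h : ∀ U ∈ b, MeasurableSet {a | (X a ∩ U).Nonempty}) :
    IsMeasurableSetValued m X := by
  intro O hO
  obtain ⟨S, hSb, rfl⟩ := hb.open_eq_sUnion hO
  obtain ⟨S', hS'_countable, hS', hS'S⟩ := TopologicalSpace.isOpen_sUnion_countable S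
    fun U hU => hb.isOpen (hSb hU)
  simp only [← hS'S, sUnion_eq_biUnion, inter_iUnion₂, nonempty_biUnion, ← exists_prop,
    ofPred_exists]
  exact .biUnion hS'_countable fun U hU => h U (hSb (hS' hU))

theorem union (hX : IsMeasurableSetValued m X) (hY : IsMeasurableSetValued m Y) :
    IsMeasurableSetValued m fun a => X a ∪ Y a := by
  intro O hO
  simp only [union_inter_distrib_right, union_nonempty]
  exact (hX O hO).union (hY O hO)

theorem iUnion {ι : Sort*} [Countable ι] {X : ι → α → Set E}
    (hX : ∀ i, IsMeasurableSetValued m (X i)) : IsMeasurableSetValued m fun a => ⋃ i, X i a := by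
  intro O hO
  simp only [iUnion_inter, nonempty_iUnion, ofPred_exists]
  exact .iUnion fun i => hX i O hO

theorem closure (hX : IsMeasurableSetValued m X) :
    IsMeasurableSetValued m fun a => closure (X a) := by
  intro O hO
  simpa only [closure_inter_open_nonempty_iff hO] using hX O hO

theorem image (hX : IsMeasurableSetValued m X) {f : E → F} (hf : Continuous f) :
    IsMeasurableSetValued m fun a => f '' X a := by
  intro O hO
  simpa only [image_inter_nonempty_iff] using hX _ (hO.preimage hf)

theorem prod [SecondCountableTopology E] [SecondCountableTopology F] {Y : α → Set F}
    (hX : IsMeasurableSetValued m X) (hY : IsMeasurableSetValued m Y) :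
    IsMeasurableSetValued m fun a => X a ×ˢ Y a := by
  refine of_isTopologicalBasis ((isBasis_countableBasis E).prod (isBasis_countableBasis F)) ?_
  rintro _ ⟨U, hU, V, hV, rfl⟩
  simp only [prod_inter_prod, prod_nonempty_iff]
  exact (hX U (isOpen_of_mem_countableBasis hU)).inter (hY V (isOpen_of_mem_countableBasis hV))

theorem closedMinkowskiSum [SecondCountableTopology E] [Add E] [ContinuousAdd E]
    (hX : IsMeasurableSetValued m X) (hY : IsMeasurableSetValued m Y) :
    IsMeasurableSetValued m fun a => closedMinkowskiSum (X a) (Y a) := by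
  simp only [BirthGrowth.closedMinkowskiSum, ← add_image_prod]
  exact ((hX.prod hY).image continuous_add).closure

theorem sdiff [SecondCountableTopology E] (hY : IsMeasurableSetValued m Y)
    (hX : IsMeasurableSetValued m X) (hX_closed : ∀ a, IsClosed (X a)) :
    IsMeasurableSetValued m fun a => Y a \ X a := by
  intro U hU
  have sdiff_inter_eq : {a | ((Y a \ X a) ∩ U).Nonempty} =
      ⋃ V ∈ {V ∈ countableBasis E | V ⊆ U},
        {a | (X a ∩ V).Nonempty}ᶜ ∩ {a | (Y a ∩ V).Nonempty} := by
    ext a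
    simp only [mem_iUnion, exists_prop]
    constructor
    · rintro ⟨y, ⟨hyY, hyX⟩, hyU⟩
      obtain ⟨V, hV, hyV, hVU⟩ := (isBasis_countableBasis E).exists_subset_of_mem_open
        (show y ∈ U \ X a from ⟨hyU, hyX⟩) (hU.sdiff (hX_closed a))
      exact ⟨V, ⟨hV, fun z hz => (hVU hz).1⟩, fun ⟨z, hzX, hzV⟩ => (hVU hzV).2 hzX, y, hyY, hyV⟩
    · rintro ⟨V, ⟨-, hVU⟩, hXV, y, hyY, hyV⟩
      exact ⟨y, ⟨hyY, fun h => hXV ⟨y, h, hyV⟩⟩, hVU hyV⟩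
  rw [sdiff_inter_eq]
  refine .biUnion ((countable_countableBasis E).mono (sep_subset _ _)) fun V hV => ?_
  have hV_open := isOpen_of_mem_countableBasis hV.1
  exact (hX V hV_open).compl.inter (hY V hV_open)

theorem compl [SecondCountableTopology E] (hX : IsMeasurableSetValued m X)
    (hX_closed : ∀ a, IsClosed (X a)) : IsMeasurableSetValued m fun a => (X a)ᶜ := by
  simpa only [compl_eq_univ_sdiff] using (const univ).sdiff hX hX_closed

end TopologicalSpace

section PseudoEMetricSpace

variable [PseudoEMetricSpace E] {X : α → Set E}

theorem measurable_infEDist (hX : IsMeasurableSetValued m X) (u : E) :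
    Measurable fun a => Metric.infEDist u (X a) := by
  refine measurable_of_Iio fun r => ?_
  convert hX (Metric.eball u r) Metric.isOpen_eball using 1
  ext a
  simp only [mem_preimage, mem_Iio, Metric.infEDist_lt_iff, mem_ofPred_eq, inter_nonempty,
    Metric.mem_eball']

theorem of_measurable_infEDist [SeparableSpace E]
    (h : ∀ u, Measurable fun a => Metric.infEDist u (X a)) : IsMeasurableSetValued m X := by
  intro O hO
  obtain ⟨D, hD_countable, hD⟩ := TopologicalSpace.exists_countable_dense E
  simp only [nonempty_inter_iff_exists_infEDist_lt hD hO, ofPred_exists, ← exists_prop]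
  exact .biUnion hD_countable fun u _ => .iUnion fun k => .iUnion fun _ =>
    measurableSet_lt (h u) measurable_const

end PseudoEMetricSpace

theorem frontier [TopologicalSpace E] [SecondCountableTopology E] [LocallyConnectedSpace E]
    {X : α → Set E} (hX : IsMeasurableSetValued m X) (hX_closed : ∀ a, IsClosed (X a)) :
    IsMeasurableSetValued m fun a => frontier (X a) := by
  refine of_isTopologicalBasis IsTopologicalBasis.isOpen_isPreconnected fun U ⟨hU, hU'⟩ => ?_
  simp only [frontier_inter_nonempty_iff hU' hU]
  exact (hX U hU).inter (hX.compl hX_closed U hU)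

theorem sdiff_interior [TopologicalSpace E] [SecondCountableTopology E] [LocallyConnectedSpace E]
    {X Y : α → Set E} (hY : IsMeasurableSetValued m Y) (hX : IsMeasurableSetValued m X)
    (hX_closed : ∀ a, IsClosed (X a)) (hXY : ∀ a, X a ⊆ Y a) :
    IsMeasurableSetValued m fun a => Y a \ interior (X a) := by
  convert (hY.sdiff hX hX_closed).union (hX.frontier hX_closed) using 2 with a
  rw [(hX_closed a).frontier_eq, sdiff_union_sdiff_cancel (hXY a) interior_subset]

theorem congr_ae {μ : Measure α} [μ.IsComplete] [TopologicalSpace E] {X Y : α → Set E}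
    (hX : IsMeasurableSetValued m X) (h : X =ᵐ[μ] Y) : IsMeasurableSetValued m Y := by
  intro O hO
  refine ((hX O hO).nullMeasurableSet (μ := μ)).congr ?_ |>.measurable_of_complete
  filter_upwards [h] with a ha
  exact congrArg (fun Z => (Z ∩ O).Nonempty) ha

end IsMeasurableSetValued

end SetValued

section Selection

variable {α E : Type*} {m : MeasurableSpace α} [MetricSpace E] [SecondCountableTopology E]
  [MeasurableSpace E] [BorelSpace E] {F : α → Set E} {g : α → E}

theorem IsMeasurableSetValued.measurable_infEDist_apply (hF : IsMeasurableSetValued m F)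
    (hg : Measurable g) : Measurable fun a => Metric.infEDist (g a) (F a) :=
  (measurable_uncurry_of_continuous_of_measurable
    (u := fun (x : E) (a : α) => Metric.infEDist x (F a))
    (fun _ => Metric.continuous_infEDist) hF.measurable_infEDist).comp (hg.prodMk measurable_id)

theorem IsMeasurableSetValued.exists_measurable_edist_lt_infEDist_lt
    (hF : IsMeasurableSetValued m F) (hg : Measurable g) {r δ : α → ℝ≥0∞} (hr : Measurable r)
    (hδ : Measurable δ) (hgr : ∀ a, Metric.infEDist (g a) (F a) < r a) (hδ_pos : ∀ a, 0 < δ a) :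
    ∃ g' : α → E, Measurable g' ∧
      ∀ a, edist (g a) (g' a) < r a ∧ Metric.infEDist (g' a) (F a) < δ a := by
  classical
  rcases isEmpty_or_nonempty E with hE | hE
  · exact ⟨g, hg, fun a => hE.elim (g a)⟩
  have exists_denseSeq (a : α) : ∃ k, edist (g a) (denseSeq E k) < r a ∧
      Metric.infEDist (denseSeq E k) (F a) < δ a := by
    obtain ⟨y, hy, hgy⟩ := Metric.infEDist_lt_iff.1 (hgr a)
    refine (denseRange_denseSeq E).exists_mem_open
      ((isOpen_Iio.preimage (continuous_const.edist continuous_id)).inter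
        (isOpen_Iio.preimage Metric.continuous_infEDist)) ⟨y, hgy, ?_⟩
    simpa [Metric.infEDist_zero_of_mem hy] using hδ_pos a
  refine ⟨fun a => denseSeq E (Nat.find (exists_denseSeq a)), ?_,
    fun a => Nat.find_spec (exists_denseSeq a)⟩
  refine (measurable_from_top (f := denseSeq E)).comp (measurable_find exists_denseSeq fun k => ?_)
  exact (measurableSet_lt (hg.edist measurable_const) hr).inter
    (measurableSet_lt (hF.measurable_infEDist _) hδ)

theorem IsMeasurableSetValued.exists_seq_measurable_infEDist_lt (hF : IsMeasurableSetValued m F)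
    (hg : Measurable g) {ε : α → ℝ≥0} (hε : Measurable ε)
    (hgε : ∀ a, Metric.infEDist (g a) (F a) < ε a) :
    ∃ s : ℕ → α → E, s 0 = g ∧ (∀ n, Measurable (s n)) ∧
      (∀ n a, Metric.infEDist (s n a) (F a) ≤ ε a / 2 ^ n) ∧
      ∀ n a, edist (s n a) (s (n + 1) a) ≤ ε a / 2 ^ n := by
  let Approx (n : ℕ) : Type _ :=
    {g : α → E // Measurable g ∧ ∀ a, Metric.infEDist (g a) (F a) < ε a / 2 ^ n}
  have exists_next (n : ℕ) (g : Approx n) :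
      ∃ g' : Approx (n + 1), ∀ a, edist (g.1 a) (g'.1 a) < ε a / 2 ^ n := by
    obtain ⟨g', hg', hgg'⟩ := hF.exists_measurable_edist_lt_infEDist_lt g.2.1
      (δ := fun a => ε a / 2 ^ (n + 1)) (hε.coe_nnreal_ennreal.div_const _)
      (hε.coe_nnreal_ennreal.div_const _) g.2.2
      fun a => ENNReal.div_pos (bot_le.trans_lt (hgε a)).ne' (by finiteness)
    exact ⟨⟨g', hg', fun a => (hgg' a).2⟩, fun a => (hgg' a).1⟩
  choose next hnext using exists_next
  let s (n : ℕ) : Approx n := Nat.rec ⟨g, hg, by simpa using hgε⟩ next n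
  exact ⟨fun n => (s n).1, rfl, fun n => (s n).2.1, fun n a => ((s n).2.2 a).le,
    fun n a => (hnext n (s n) a).le⟩

variable [CompleteSpace E]

theorem IsMeasurableSetValued.exists_measurable_selection_edist_le (hF : IsMeasurableSetValued m F)
    (hF_closed : ∀ a, IsClosed (F a)) (hg : Measurable g) {ε : α → ℝ≥0} (hε : Measurable ε)
    (hgε : ∀ a, Metric.infEDist (g a) (F a) < ε a) :
    ∃ f : α → E, Measurable f ∧ (∀ a, f a ∈ F a) ∧ ∀ a, edist (g a) (f a) ≤ 2 * ε a := by
  obtain ⟨s, rfl, hs, hsF, hs_edist⟩ := hF.exists_seq_measurable_infEDist_lt hg hε hgε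
  have exists_lim (a : α) : ∃ x, Tendsto (fun n => s n a) atTop (𝓝 x) :=
    cauchySeq_tendsto_of_complete
      (cauchySeq_of_edist_le_geometric_two (ε a) ENNReal.coe_ne_top fun n => hs_edist n a)
  choose f hf using exists_lim
  refine ⟨f, measurable_of_tendsto_metrizable hs (tendsto_pi_nhds.2 hf), fun a => ?_, fun a =>
    edist_le_of_edist_le_geometric_two_of_tendsto₀ (ε a) (fun n => hs_edist n a) (hf a)⟩
  have tendsto_zero : Tendsto (fun n : ℕ => (ε a : ℝ≥0∞) / 2 ^ n) atTop (𝓝 0) := by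
    simpa [div_eq_mul_inv, ENNReal.inv_pow] using ENNReal.Tendsto.const_mul
      (ENNReal.tendsto_pow_atTop_nhds_zero_of_lt_one ENNReal.one_half_lt_one)
      (Or.inr (ENNReal.coe_ne_top (r := ε a)))
  rw [Metric.mem_iff_infEDist_zero_of_closed (hF_closed a), ← nonpos_iff_eq_zero]
  exact le_of_tendsto_of_tendsto' ((Metric.continuous_infEDist.tendsto _).comp (hf a))
    tendsto_zero fun n => hsF n a

theorem IsRandomClosedSet.exists_measurable_selection_edist_le (hF : IsRandomClosedSet m F)
    (hg : Measurable g) {η : α → ℝ≥0} (hη : Measurable η) (hη_pos : ∀ a, 0 < η a) :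
    ∃ f : α → E, Measurable f ∧ (∀ a, f a ∈ F a) ∧
      ∀ a, edist (g a) (f a) ≤ Metric.infEDist (g a) (F a) + η a := by
  have hη3 (a : α) : (0 : ℝ≥0∞) < ↑(η a / 3) := by exact_mod_cast div_pos (hη_pos a) three_pos
  obtain ⟨g', hg', hgg'⟩ := hF.measurable.exists_measurable_edist_lt_infEDist_lt hg
    (δ := fun a => ↑(η a / 3))
    ((hF.measurable.measurable_infEDist_apply hg).add (hη.div_const 3).coe_nnreal_ennreal)
    (hη.div_const 3).coe_nnreal_ennreal
    (fun a => ENNReal.lt_add_right (Metric.infEDist_ne_top (hF.nonempty a)) (hη3 a).ne') hη3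
  obtain ⟨f, hf, hfF, hf_edist⟩ := hF.measurable.exists_measurable_selection_edist_le hF.isClosed
    hg' (hη.div_const 3) fun a => (hgg' a).2
  refine ⟨f, hf, hfF, fun a => ?_⟩
  calc edist (g a) (f a) ≤ edist (g a) (g' a) + edist (g' a) (f a) := edist_triangle _ _ _
    _ ≤ (Metric.infEDist (g a) (F a) + ↑(η a / 3)) + 2 * ↑(η a / 3) :=
      add_le_add (hgg' a).1.le (hf_edist a)
    _ = Metric.infEDist (g a) (F a) + η a := by
      rw [add_assoc]
      norm_cast
      field_simp
      norm_num

end Selection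

section Aumann

variable {Ω α E : Type*} {mΩ : MeasurableSpace Ω} [MeasurableSpace α] [NormedAddCommGroup E]
  {μ : Measure α}

theorem IsRandomClosedSet.exists_integrable_selection_lintegral_edist_le [MeasurableSpace E]
    [BorelSpace E] [SecondCountableTopology E] [CompleteSpace E] [SigmaFinite μ] {X : α → Set E}
    (hX : IsRandomClosedSet inferInstance X) {h : α → E} (hh : Measurable h)
    (hh_int : Integrable h μ) (hhX : ∫⁻ a, Metric.infEDist (h a) (X a) ∂μ ≠ ∞) {ε : ℝ≥0}
    (hε : 0 < ε) :
    ∃ f : α → E, Integrable f μ ∧ (∀ a, f a ∈ X a) ∧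
      ∫⁻ a, edist (h a) (f a) ∂μ ≤ ∫⁻ a, Metric.infEDist (h a) (X a) ∂μ + ε := by
  obtain ⟨η, hη_pos, hη, hη_lt⟩ :=
    exists_pos_lintegral_lt_of_sigmaFinite μ (ENNReal.coe_pos.2 hε).ne'
  obtain ⟨f, hf, hfX, hf_edist⟩ := hX.exists_measurable_selection_edist_le hh hη hη_pos
  have lintegral_le : ∫⁻ a, edist (h a) (f a) ∂μ ≤
      ∫⁻ a, Metric.infEDist (h a) (X a) ∂μ + ε := by
    grw [← hη_lt, ← lintegral_add_right _ hη.coe_nnreal_ennreal]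
    exact lintegral_mono hf_edist
  have hhf : Integrable (h - f) μ := by
    refine ⟨(hh.sub hf).aestronglyMeasurable, ?_⟩
    simp only [HasFiniteIntegral, Pi.sub_apply, ← edist_eq_enorm_sub]
    exact lintegral_le.trans_lt (ENNReal.add_lt_top.2 ⟨hhX.lt_top, ENNReal.coe_lt_top⟩)
  exact ⟨f, by simpa using hh_int.sub hhf, hfX, lintegral_le⟩

/-- The set `S¹_X` of integrable selections of the set-valued map `X`, as a subset of `L¹`. Being
a selection almost everywhere does not depend on the representative. -/
def integrableSelections (μ : Measure α) (X : α → Set E) : Set (α →₁[μ] E) :=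
  {f | ∀ᵐ a ∂μ, f a ∈ X a}

theorem toL1_mem_integrableSelections_iff {X : α → Set E} {f : α → E} (hf : Integrable f μ) :
    hf.toL1 f ∈ integrableSelections μ X ↔ ∀ᵐ a ∂μ, f a ∈ X a := by
  refine eventually_congr (f := ae μ) ?_
  filter_upwards [hf.coeFn_toL1] with a ha
  rw [ha]

theorem infEDist_integrableSelections [SecondCountableTopology E] [CompleteSpace E] [SigmaFinite μ]
    {X : α → Set E} (hX : IsRandomClosedSet inferInstance X) (h : α →₁[μ] E) :
    Metric.infEDist h (integrableSelections μ X) = ∫⁻ a, Metric.infEDist (h a) (X a) ∂μ := by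
  borelize E
  refine le_antisymm (ENNReal.le_of_forall_pos_le_add fun ε hε hhX => ?_) ?_
  · obtain ⟨f, hf, hfX, hf_edist⟩ := hX.exists_integrable_selection_lintegral_edist_le
      (Lp.stronglyMeasurable h).measurable (L1.integrable_coeFn h) hhX.ne hε
    calc Metric.infEDist h (integrableSelections μ X) ≤ edist h (hf.toL1 f) :=
          Metric.infEDist_le_edist_of_mem <|
            (toL1_mem_integrableSelections_iff hf).2 (.of_forall hfX)
      _ = ∫⁻ a, edist (h a) (f a) ∂μ := by
          rw [L1.edist_def]
          refine lintegral_congr_ae ?_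
          filter_upwards [hf.coeFn_toL1] with a ha
          rw [ha]
      _ ≤ ∫⁻ a, Metric.infEDist (h a) (X a) ∂μ + ε := hf_edist
  · refine Metric.le_infEDist.2 fun f hf => ?_
    rw [L1.edist_def]
    refine lintegral_mono_ae ?_
    filter_upwards [hf] with a ha
    exact Metric.infEDist_le_edist_of_mem ha

theorem IsRandomClosedSet.isMeasurableSetValued_integrableSelections [CompleteSpace E]
    [SecondCountableTopology E] [SigmaFinite μ] [IsSeparable μ] {G : Ω × α → Set E}
    (hG : IsRandomClosedSet inferInstance G) :
    IsMeasurableSetValued mΩ fun ω => integrableSelections μ fun a => G (ω, a) := by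
  borelize E
  have : Fact ((1 : ℝ≥0∞) ≠ ⊤) := ⟨ENNReal.one_ne_top⟩
  refine .of_measurable_infEDist fun h => ?_
  have isRandomClosedSet_section (ω : Ω) :
      IsRandomClosedSet inferInstance fun a => G (ω, a) :=
    ⟨fun a => hG.nonempty _, fun a => hG.isClosed _,
      fun O hO => measurable_prodMk_left (hG.measurable O hO)⟩
  simp only [fun ω => infEDist_integrableSelections (isRandomClosedSet_section ω) h]
  have hh : Measurable fun q : Ω × α => h q.2 :=
    (Lp.stronglyMeasurable h).measurable.comp measurable_snd
  exact (hG.measurable.measurable_infEDist_apply hh).lintegral_prod_right'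

variable [NormedSpace ℝ E]

theorem aumannIntegral_eq_image (A : Set α) (X : α → Set E) :
    aumannIntegral μ A X = (fun f : α →₁[μ] E => ∫ a in A, f a ∂μ) '' integrableSelections μ X := by
  ext y
  constructor
  · rintro ⟨x, hx, hxX, rfl⟩
    exact ⟨hx.toL1 x, (toL1_mem_integrableSelections_iff hx).2 hxX,
      integral_congr_ae (ae_restrict_of_ae hx.coeFn_toL1)⟩
  · rintro ⟨f, hf, rfl⟩
    exact ⟨f, L1.integrable_coeFn f, hf, rfl⟩

theorem IsRandomClosedSet.isMeasurableSetValued_aumannIntegral [CompleteSpace E]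
    [SecondCountableTopology E] [SigmaFinite μ] [IsSeparable μ] {G : Ω × α → Set E}
    (hG : IsRandomClosedSet inferInstance G) (A : Set α) :
    IsMeasurableSetValued mΩ fun ω => aumannIntegral μ A fun a => G (ω, a) := by
  simp only [aumannIntegral_eq_image]
  exact hG.isMeasurableSetValued_integrableSelections.image (continuous_setIntegral A)

end Aumann

section EventuallyMeasurable

variable {α β E : Type*} {m : MeasurableSpace α} {l : Filter α} [l.IsMeasurablyGenerated]

theorem isMeasurablyGenerated_comap [MeasurableSpace β] {f : β → α} (hf : Measurable f) :
    (comap f l).IsMeasurablyGenerated where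
  exists_measurable_subset := by
    rintro S ⟨A, hA, hAS⟩
    obtain ⟨A', hA', hA'_meas, hA'A⟩ := IsMeasurablyGenerated.exists_measurable_subset hA
    exact ⟨f ⁻¹' A', preimage_mem_comap hA', hf hA'_meas, (preimage_mono hA'A).trans hAS⟩

theorem IsRandomClosedSet.exists_eventuallyEq_of_eventuallyMeasurableSpace
    [CountableInterFilter l] [TopologicalSpace E] [SecondCountableTopology E] {X : α → Set E}
    (hX : IsRandomClosedSet (eventuallyMeasurableSpace m l) X) :
    ∃ X' : α → Set E, IsRandomClosedSet m X' ∧ X' =ᶠ[l] X := by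
  classical
  have exists_measurableSet (U : Set E) (hU : U ∈ countableBasis E) :
      ∃ S, MeasurableSet S ∧ ∀ᶠ a in l, a ∈ S ↔ (X a ∩ U).Nonempty := by
    obtain ⟨S, hS, h⟩ := hX.measurable U (isOpen_of_mem_countableBasis hU)
    exact ⟨S, hS, by filter_upwards [h] with a ha using (iff_of_eq ha).symm⟩
  choose! S hS hSX using exists_measurableSet
  obtain ⟨A, hAl, hA, hSXA⟩ := ((eventually_countable_ball (countable_countableBasis E)).2
    hSX).exists_measurable_mem
  refine ⟨fun a => if a ∈ A then X a else univ, ⟨fun a => ?_, fun a => ?_, ?_⟩, ?_⟩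
  · split_ifs with ha
    exacts [hX.nonempty a, (hX.nonempty a).mono (subset_univ _)]
  · split_ifs with ha
    exacts [hX.isClosed a, isClosed_univ]
  · refine .of_isTopologicalBasis (isBasis_countableBasis E) fun U hU => ?_
    have : {a | ((if a ∈ A then X a else univ) ∩ U).Nonempty} =
        A.ite (S U) {_a | U.Nonempty} := by
      ext a
      by_cases ha : a ∈ A
      · simp [ha, hSXA a ha U hU, Set.ite]
      · simp [ha, Set.ite]
    rw [this]
    exact hA.ite (hS U hU) (.const _)
  · filter_upwards [hAl] with a ha
    simp [ha]

end EventuallyMeasurable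

section LeftGrid

/-- The largest point of the grid `ℤ / (n + 1)` strictly below `x`. A left-continuous process is
the limit of its values there, and the grid being countable makes these jointly measurable. -/
noncomputable def leftGridPoint (n : ℕ) (x : ℝ) : ℝ :=
  ((⌈x * (n + 1)⌉ - 1 : ℤ) : ℝ) / (n + 1)

theorem leftGridPoint_lt (n : ℕ) (x : ℝ) : leftGridPoint n x < x := by
  rw [leftGridPoint, div_lt_iff₀ (by positivity)]
  push_cast
  linarith [Int.ceil_lt_add_one (x * (n + 1))]

theorem sub_one_div_le_leftGridPoint (n : ℕ) (x : ℝ) : x - 1 / (n + 1) ≤ leftGridPoint n x := by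
  have hn : (0 : ℝ) < n + 1 := by positivity
  rw [leftGridPoint, le_div_iff₀ hn, sub_mul, one_div_mul_cancel hn.ne']
  push_cast
  linarith [Int.le_ceil (x * (n + 1))]

theorem tendsto_leftGridPoint (x : ℝ) :
    Tendsto (fun n => leftGridPoint n x) atTop (𝓝[<] x) := by
  refine tendsto_nhdsWithin_iff.2 ⟨?_, .of_forall fun n => leftGridPoint_lt n x⟩
  refine tendsto_of_tendsto_of_tendsto_of_le_of_le ?_ tendsto_const_nhds
    (fun n => sub_one_div_le_leftGridPoint n x) fun n => (leftGridPoint_lt n x).le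
  simpa using tendsto_const_nhds.sub (tendsto_one_div_add_atTop_nhds_zero_nat (𝕜 := ℝ))

variable {Ω γ : Type*} {mΩ : MeasurableSpace Ω} [MeasurableSpace γ]

theorem measurable_comp_leftGridPoint (n : ℕ) {g : Ω → ℝ → γ}
    (hg : ∀ x, Measurable fun ω => g ω x) :
    Measurable fun q : Ω × ℝ => g q.1 (leftGridPoint n q.2) := by
  have hg' : Measurable fun q : Ω × ℤ => g q.1 (((q.2 - 1 : ℤ) : ℝ) / (n + 1)) :=
    measurable_from_prod_countable_left fun k => hg (((k - 1 : ℤ) : ℝ) / (n + 1))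
  have hceil : Measurable fun q : Ω × ℝ => (q.1, ⌈q.2 * (n + 1)⌉) := by fun_prop
  exact hg'.comp hceil

end LeftGrid

section Previsible

variable {Ω E : Type*} {mΩ : MeasurableSpace Ω} {t₀ T : ℝ} {ℙ : Measure Ω}
  {ℱ : Filtration (Icc t₀ T) mΩ}

theorem tendsto_infEDist_of_tendsto_hausdorffEDist [PseudoEMetricSpace E] {ι : Type*}
    {l : Filter ι} {X : ι → Set E} {Y : Set E}
    (h : Tendsto (fun i => Metric.hausdorffEDist (X i) Y) l (𝓝 0)) (u : E) :
    Tendsto (fun i => Metric.infEDist u (X i)) l (𝓝 (Metric.infEDist u Y)) := by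
  refine tendsto_of_tendsto_of_tendsto_of_le_of_le
    (g := fun i => Metric.infEDist u Y - Metric.hausdorffEDist (X i) Y)
    (h := fun i => Metric.infEDist u Y + Metric.hausdorffEDist (X i) Y) ?_ ?_
    (fun i => tsub_le_iff_right.2 Metric.infEDist_le_infEDist_add_hausdorffEDist) fun i => ?_
  · simpa using ENNReal.Tendsto.sub (tendsto_const_nhds (x := Metric.infEDist u Y)) h
      (Or.inr ENNReal.zero_ne_top)
  · simpa using (tendsto_const_nhds (x := Metric.infEDist u Y)).add h
  · dsimp only
    rw [Metric.hausdorffEDist_comm]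
    exact Metric.infEDist_le_infEDist_add_hausdorffEDist

/-- The completion of the product σ-algebra on `Ω × β` by the evanescent sets, that is, by the
sets with `ℙ`-null projection to `Ω`. It contains the previsible σ-algebra, whose generators are
left-continuous only almost surely. The evanescent sets are the complements of the members of the
filter `comap Prod.fst (ae ℙ)`. -/
abbrev evanescentCompletion (β : Type*) [MeasurableSpace β] (ℙ : Measure Ω) :
    MeasurableSpace (Ω × β) :=
  eventuallyMeasurableSpace inferInstance (comap Prod.fst (ae ℙ))

theorem measurable_evanescentCompletion_of_leftContinuous {f : Ω → Icc t₀ T → ℝ≥0∞}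
    (hf : ∀ t, Measurable fun ω => f ω t)
    (hf_left : ∀ᵐ ω ∂ℙ, ∀ t, Tendsto (f ω) (𝓝[<] t) (𝓝 (f ω t))) :
    Measurable[evanescentCompletion (Icc t₀ T) ℙ] fun q : Ω × Icc t₀ T => f q.1 q.2 := by
  rcases lt_or_ge T t₀ with hT | hT
  · have : IsEmpty (Icc t₀ T) := ⟨fun t => hT.not_ge (t.2.1.trans t.2.2)⟩
    exact (measurable_of_empty _).mono le_eventuallyMeasurableSpace le_rfl
  let f' (ω : Ω) (x : ℝ) : ℝ≥0∞ := f ω (projIcc t₀ T hT x)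
  have hf' : Measurable fun q : Ω × Icc t₀ T =>
      limsup (fun n => f' q.1 (leftGridPoint n q.2)) atTop :=
    .limsup fun n => (measurable_comp_leftGridPoint n (g := f') fun x => hf _).comp
      (measurable_fst.prodMk (measurable_subtype_coe.comp measurable_snd))
  refine Measurable.eventuallyMeasurable_of_eventuallyEq hf' ?_
  refine (hf_left.comap Prod.fst).mono ?_
  rintro ⟨ω, t⟩ hω
  have hproj : Tendsto (fun n => projIcc t₀ T hT (leftGridPoint n t)) atTop (𝓝[≤] t) := by
    refine tendsto_nhdsWithin_iff.2 ⟨?_, .of_forall fun n => ?_⟩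
    · simpa [Function.comp_def] using (continuous_projIcc (h := hT)).tendsto (t : ℝ) |>.comp
        ((tendsto_leftGridPoint (t : ℝ)).mono_right nhdsWithin_le_nhds)
    · simpa using monotone_projIcc hT (leftGridPoint_lt n (t : ℝ)).le
  have hft : Tendsto (f ω) (𝓝[≤] t) (𝓝 (f ω t)) := continuousWithinAt_Iio_iff_Iic.1 (hω t)
  exact (hft.comp hproj).limsup_eq.symm

theorem previsible_le_evanescentCompletion [PseudoEMetricSpace E] [SeparableSpace E] :
    previsible E ℙ ℱ ≤ evanescentCompletion (Icc t₀ T) ℙ := by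
  refine MeasurableSpace.generateFrom_le ?_
  rintro _ ⟨X, O, hX, hX_left, hO, rfl⟩
  refine IsMeasurableSetValued.of_measurable_infEDist
    (X := fun q : Ω × Icc t₀ T => X q.1 q.2) (fun u => ?_) O hO
  refine measurable_evanescentCompletion_of_leftContinuous
    (f := fun ω t => Metric.infEDist u (X ω t))
    (fun t => ((hX t).measurable.mono (ℱ.le t)).measurable_infEDist u) ?_
  filter_upwards [hX_left] with ω hω t
  exact tendsto_infEDist_of_tendsto_hausdorffEDist (hω t) u

theorem exists_isRandomClosedSet_of_previsible [PseudoEMetricSpace E] [SecondCountableTopology E]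
    {G : Ω → Icc t₀ T → Set E}
    (hG : IsRandomClosedSet (previsible E ℙ ℱ) fun q => G q.1 q.2) :
    ∃ G' : Ω × Icc t₀ T → Set E, IsRandomClosedSet inferInstance G' ∧
      ∀ᵐ ω ∂ℙ, ∀ t, G' (ω, t) = G ω t := by
  have := isMeasurablyGenerated_comap (l := ae ℙ) (measurable_fst (α := Ω) (β := Icc t₀ T))
  obtain ⟨G', hG', hG'G⟩ := IsRandomClosedSet.exists_eventuallyEq_of_eventuallyMeasurableSpace
    ⟨hG.nonempty, hG.isClosed, hG.measurable.mono previsible_le_evanescentCompletion⟩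
  refine ⟨G', hG', ?_⟩
  filter_upwards [eventually_comap.1 hG'G] with ω hω t using hω (ω, t) rfl

end Previsible


section Sums

variable {Ω E : Type*} {mΩ : MeasurableSpace Ω} {t₀ T : ℝ} {ℙ : Measure Ω}
  {ℱ : Filtration (Icc t₀ T) mΩ} [NormedAddCommGroup E] [NormedSpace ℝ E]
  {B G : Ω → Icc t₀ T → Set E}

instance isFiniteMeasure_lebesgueIcc : IsFiniteMeasure (lebesgueIcc t₀ T) := by
  constructor
  rw [lebesgueIcc, comap_subtype_coe_apply measurableSet_Icc, image_univ, Subtype.range_coe]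
  exact measure_Icc_lt_top

theorem isMeasurableSetValued_growth [CompleteSpace E] [SecondCountableTopology E] [ℙ.IsComplete]
    (hG : IsRandomClosedSet (previsible E ℙ ℱ) fun q => G q.1 q.2) (a b : Icc t₀ T) :
    IsMeasurableSetValued mΩ (growth G a b) := by
  obtain ⟨G', hG', hG'G⟩ := exists_isRandomClosedSet_of_previsible hG
  refine (hG'.isMeasurableSetValued_aumannIntegral (μ := lebesgueIcc t₀ T)
    (Icc a b)).congr_ae (μ := ℙ) ?_
  filter_upwards [hG'G] with ω hω
  simp only [growth, hω]

theorem isMeasurableSetValued_increment [SecondCountableTopology E] (hB : IsAdaptedClosed ℱ B)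
    (hB_mono : ∀ ω, Monotone (B ω)) {n : ℕ} {p : Fin (n + 1) → Icc t₀ T} (hp : Monotone p)
    (i : Fin n) : IsMeasurableSetValued mΩ (increment B p i) :=
  ((hB _).measurable.mono (ℱ.le _)).sdiff_interior ((hB _).measurable.mono (ℱ.le _))
    (hB _).isClosed fun ω => hB_mono ω (hp i.castSucc_le_succ)

theorem isRandomClosedSet_union_iUnion_increment [CompleteSpace E] [SecondCountableTopology E]
    [ℙ.IsComplete] (hB : IsAdaptedClosed ℱ B) (hB_mono : ∀ ω, Monotone (B ω))
    (hG : IsRandomClosedSet (previsible E ℙ ℱ) fun q => G q.1 q.2)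
    (hG_int : ∀ ω, (integrableSelections (lebesgueIcc t₀ T) (G ω)).Nonempty)
    (t : Icc t₀ T) {n : ℕ} {p : Fin (n + 1) → Icc t₀ T} (hp : Monotone p)
    (c : Fin n → Fin (n + 1)) :
    IsRandomClosedSet mΩ fun ω =>
      closedMinkowskiSum (B ω (p 0)) (growth G (p 0) t ω) ∪
        ⋃ i : Fin n, closedMinkowskiSum (increment B p i ω) (growth G (p (c i)) t ω) where
  nonempty ω := by
    have growth_nonempty : (growth G (p 0) t ω).Nonempty := by
      rw [growth, aumannIntegral_eq_image]
      exact (hG_int ω).image _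
    exact (((hB (p 0)).nonempty ω).add growth_nonempty).closure.inl
  isClosed ω := isClosed_closure.union (isClosed_iUnion_of_finite fun _ => isClosed_closure)
  measurable := (((hB (p 0)).measurable.mono (ℱ.le _)).closedMinkowskiSum
    (isMeasurableSetValued_growth hG _ _)).union <| .iUnion fun i =>
      (isMeasurableSetValued_increment hB hB_mono hp i).closedMinkowskiSum
        (isMeasurableSetValued_growth hG _ _)

end Sums

end BirthGrowth

theorem mainTheorem8_general
    {E : Type*} [NormedAddCommGroup E] [NormedSpace ℝ E] [CompleteSpace E]
    [TopologicalSpace.SeparableSpace E] {t₀ T : ℝ} {Ω : Type*} {mΩ : MeasurableSpace Ω}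
    (ℙ : Measure Ω) [ℙ.IsComplete] (ℱ : Filtration (Icc t₀ T) mΩ) (B G : Ω → Icc t₀ T → Set E)
    (hB_adapted : BirthGrowth.IsAdaptedClosed ℱ B) (hB_mono : ∀ ω, Monotone (B ω))
    (hG : BirthGrowth.IsRandomClosedSet (BirthGrowth.previsible E ℙ ℱ) fun q => G q.1 q.2)
    (hG_int : ∀ ω,
      (BirthGrowth.integrableSelections (BirthGrowth.lebesgueIcc t₀ T) (G ω)).Nonempty)
    (t : Icc t₀ T) (n : ℕ) (p : Fin (n + 1) → Icc t₀ T) (hp : BirthGrowth.IsPartition t p) :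
    BirthGrowth.IsRandomClosedSet mΩ (BirthGrowth.lowerSum B G t p) ∧
      BirthGrowth.IsRandomClosedSet mΩ (BirthGrowth.upperSum B G t p) := by
  have := UniformSpace.secondCountable_of_separable E
  have isRandomClosedSet_sum := BirthGrowth.isRandomClosedSet_union_iUnion_increment
    hB_adapted hB_mono hG hG_int t hp.strictMono.monotone
  exact ⟨isRandomClosedSet_sum Fin.succ, isRandomClosedSet_sum Fin.castSucc⟩

theorem mainTheorem8
    {E : Type*} [NormedAddCommGroup E] [NormedSpace ℝ E] [CompleteSpace E]
    (hrefl : BirthGrowth.IsReflexiveSpace E)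
    (hsep : TopologicalSpace.SeparableSpace (StrongDual ℝ E))
    {t₀ T : ℝ}
    {Ω : Type*} {mΩ : MeasurableSpace Ω} (ℙ : Measure Ω) [IsProbabilityMeasure ℙ]
    [ℙ.IsComplete]
    (ℱ : Filtration (Icc t₀ T) mΩ) (hℱ : BirthGrowth.UsualConditions ℙ ℱ)
    (B G : Ω → Icc t₀ T → Set E)
    (hB_adapted : BirthGrowth.IsAdaptedClosed ℱ B)
    (hB_mono : ∀ ω, ∀ s t : Icc t₀ T, s < t → B ω s ⊆ B ω t)
    (hG_closed : ∀ ω t, IsClosed (G ω t))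
    (hG_zero : ∀ ω t, (0 : E) ∈ G ω t)
    (hG_convex : ∀ ω t, Convex ℝ (G ω t))
    (hG_bounded : ∃ K : Set E, IsClosed K ∧ Bornology.IsBounded K ∧ ∀ ω t, G ω t ⊆ K)
    (hG_previsible : BirthGrowth.IsMeasurableSetValued (BirthGrowth.previsible E ℙ ℱ)
      (fun p : Ω × Icc t₀ T => G p.1 p.2))
    (t : Icc t₀ T) (n : ℕ) (p : Fin (n + 1) → Icc t₀ T) (hp : BirthGrowth.IsPartition t p) :
    BirthGrowth.IsRandomClosedSet mΩ (BirthGrowth.lowerSum B G t p) ∧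
      BirthGrowth.IsRandomClosedSet mΩ (BirthGrowth.upperSum B G t p) := by
  have := BirthGrowth.separableSpace_of_separableSpace_dual ℝ E
  exact mainTheorem8_general ℙ ℱ B G hB_adapted (fun ω => monotone_iff_forall_lt.2 (hB_mono ω))
    ⟨fun _ => ⟨0, hG_zero _ _⟩, fun _ => hG_closed _ _, hG_previsible⟩
    (fun ω => ⟨(integrable_zero _ E _).toL1,
      (BirthGrowth.toL1_mem_integrableSelections_iff _).2 (.of_forall (hG_zero ω))⟩) t n p hp
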